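/- Let $R$ be a Noetherian commutative ring, $I\subseteq R$ an ideal, and $M$ an $I$-filtered module, i.e. a finitely generated $R$-module with a filtration $M=M_0\supseteq M_1\supseteq M_2\supseteq\cdots$ by submodules such that $IM_n\subseteq M_{n+1}$ for all $n$ and $\bigoplus_{n\ge 0} M_n$ is a finitely generated module over the Rees ring $\bigoplus_{n\ge 0} I^n$. A prime filtration of an $R$-module $N$ is a finite chain of submodules $0=N_0\subset N_1\subset\cdots\subset N_l=N$ such that each factor $N_i/N_{i-1}$ is isomorphic to $R/P_i$ for some prime ideal $P_i$; the set $\{P_1,\dots,P_l\}$ is its set of prime factors, and the multiplicity of a prime $P$ in it is the number of $i$ with $N_i/N_{i-1}\cong R/P$. Then there exist a finite set $\Lambda$ of prime ideals of $R$ and, for every $n\ge 0$, a prime filtration of $M/M_n$ all of whose prime factors lie in $\Lambda$, such that, if $\dim M$ (the Krull dimension of the support of $M$) is finite, then for every $P\in\Lambda$ the multiplicity of $P$ in the chosen filtration of $M/M_n$ is $O(n^{\dim M})$ as $n\to\infty$. (If $M=0$, all multiplicities are zero.) Furthermore, if $R$ has infinite residue fields (that is, $R/\mathfrak m$ is infinite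 for every maximal ideal $\mathfrak m$), then $\Lambda$ and these prime filtrations can be chosen so that, in addition, there is a subset $\Lambda'\subseteq\Lambda$ such that for all sufficiently large $n$ the set of prime factors of the chosen filtration of $M/M_n$ is exactly $\Lambda'$. -/

import Mathlib

open Filter Asymptotics

universe u v

/-- A module `M` over `R` together with an `I`-filtration `M = M₀ ⊇ M₁ ⊇ ⋯` (so `I Mₙ ⊆ Mₙ₊₁`) is an
`I`-filtered module if `M` is finite over `R`, the filtration starts at `M₀ = M`, and `⨁ Mₙ` is a
finitely generated module over the Rees ring `⨁ Iⁿ`. -/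
structure Ideal.Filtration.IsFilteredModule {R : Type u} [CommRing R] {I : Ideal R}
    {M : Type v} [AddCommGroup M] [Module R M] (F : I.Filtration M) : Prop where
  finite : Module.Finite R M
  zero_eq_top : F.N 0 = ⊤
  rees_fg : F.submodule.FG

/-- A prime filtration `0 = N₀ ⊂ N₁ ⊂ ⋯ ⊂ N_l = N` of an `R`-module `N`: a finite chain of
submodules in which every `Nᵢ₊₁ / Nᵢ` is isomorphic to `R / P` for some prime ideal `P`.
(The inclusions are automatically strict, since `R / P ≠ 0`.) -/
structure PrimeFiltration (R : Type u) [CommRing R] (N : Type v) [AddCommGroup N] [Module R N] where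
  series : RelSeries {(N₁, N₂) : Submodule R N × Submodule R N |
    Submodule.IsQuotientEquivQuotientPrime N₁ N₂}
  head_eq_bot : series.head = ⊥
  last_eq_top : series.last = ⊤

namespace PrimeFiltration

variable {R : Type u} [CommRing R] {N : Type v} [AddCommGroup N] [Module R N]

/-- The `i`-th factor `Nᵢ₊₁ / Nᵢ` of the prime filtration is isomorphic to `R / P`. -/
def FactorIso (F : PrimeFiltration R N) (i : Fin F.series.length) (P : PrimeSpectrum R) : Prop :=
  Nonempty ((↥(F.series i.succ) ⧸ (F.series i.castSucc).submoduleOf (F.series i.succ)) ≃ₗ[R]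
    (R ⧸ P.asIdeal))

/-- The set of prime factors of a prime filtration. -/
def factors (F : PrimeFiltration R N) : Set (PrimeSpectrum R) :=
  {P | ∃ i, F.FactorIso i P}

/-- The multiplicity of the prime `P` in a prime filtration: the number of factors `Nᵢ₊₁ / Nᵢ`
that are isomorphic to `R / P`. -/
noncomputable def multiplicity (F : PrimeFiltration R N) (P : PrimeSpectrum R) : ℕ :=
  {i | F.FactorIso i P}.ncard

end PrimeFiltration

/-!
Let `G = ⨁ Mₙ / Mₙ₊₁` be the associated graded module, a finitely generated graded module over
`S = R[Xᵢ : i ∈ σ]`, where `Xᵢ` acts as a generator `aᵢ` of `I`, raising the degree by one.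
Concatenating prime filtrations of the pieces `Mₖ / Mₖ₊₁`, `k < n`, gives one of `M / Mₙ`. So it is
enough to find prime filtrations of the pieces `Gₖ` with factors in a common finite set, such that
the pieces below degree `n` have `O(n ^ dim M)` factors altogether. The sets of factors of the
concatenations increase with `n` inside a finite set, hence are eventually constant.

The existence of such filtrations passes to extensions and shifts of graded modules
(`HasPrimeFactorsGrowth.of_shift`). By Noetherian induction on the graded submodules of `G`, that is,
on the filtrations between `n ↦ Mₙ₊₁` and `M`, this reduces the question to cyclic graded modules
`S / J` with `J` homogeneous (`Ideal.Filtration.hasPrimeFactorsGrowth_of_fg`).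

These are treated by Noetherian induction on `J` (`hasPrimeFactorsGrowth_gradedPiece`). If `J` is not
prime, choose homogeneous `f, g ∉ J` with `f g ∈ J`, and use that `S / J` is an extension of
`S / (J + f)` by a shift of `S / (J : f)`. If `J` is prime and contains all `Xᵢ`, then `S / J` is
`R / (J ∩ R)`. If `J` is prime and `x ∉ J` has degree one, multiplication by `x` filters `(S / J)ₙ` by
the pieces of degree at most `n` of `S / (J + x)`: no new primes occur, and the exponent of growth
increases by one while the dimension of the relevant homogeneous primes drops by one.

The exponent is thus bounded by the maximum of `dim (S / Q)` over the homogeneous primes `Q ⊇ J` not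
containing all `Xᵢ`. That this is at most `dim M` (`mem_relevantDimBounds`) follows from the bound
`dim (R / 𝔭) + 1` for the dimension of the Rees algebra of a Noetherian domain `R / 𝔭`
(`ringKrullDim_quotient_comap_toRees_le`), because `Q` strictly contains the kernel of the map from
`S` to such a Rees algebra.
-/

universe w w'

/-! ### Modules with a prescribed list of prime factors -/

/-- `HasPrimeFactors R l N` says that `N` has a prime filtration whose successive factors, read from
the top down, are `R ⧸ P` for the primes `P` in the list `l`. -/
def HasPrimeFactors (R : Type u) [CommRing R] : List (PrimeSpectrum R) →
    ∀ (N : Type v) [AddCommGroup N] [Module R N], Prop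
  | [], N, _, _ => Subsingleton N
  | P :: l, N, _, _ => ∃ K : Submodule R N,
      HasPrimeFactors R l K ∧ Nonempty ((N ⧸ K) ≃ₗ[R] (R ⧸ P.asIdeal))

namespace HasPrimeFactors

variable {R : Type u} [CommRing R]

theorem congr {l : List (PrimeSpectrum R)} {N : Type v} [AddCommGroup N] [Module R N]
    {N' : Type w} [AddCommGroup N'] [Module R N'] (e : N ≃ₗ[R] N')
    (h : HasPrimeFactors R l N) : HasPrimeFactors R l N' := by
  induction l generalizing N N' with
  | nil =>
    have : Subsingleton N := h
    exact e.symm.toEquiv.subsingleton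
  | cons P l ih =>
    obtain ⟨K, hK, ⟨φ⟩⟩ := h
    exact ⟨K.map e.toLinearMap, ih (e.submoduleMap K) hK,
      ⟨(Submodule.Quotient.equiv K _ e rfl).symm.trans φ⟩⟩

/-- Prime filtrations of the ends of a short exact sequence combine to one of the middle term. -/
theorem of_exact {l' l'' : List (PrimeSpectrum R)} {N' : Type v} [AddCommGroup N'] [Module R N']
    {N : Type w} [AddCommGroup N] [Module R N] {N'' : Type w'} [AddCommGroup N''] [Module R N'']
    {f : N' →ₗ[R] N} {g : N →ₗ[R] N''} (hf : Function.Injective f) (hg : Function.Surjective g)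
    (hfg : Function.Exact f g) (h' : HasPrimeFactors R l' N') (h'' : HasPrimeFactors R l'' N'') :
    HasPrimeFactors R (l'' ++ l') N := by
  induction l'' generalizing N N'' with
  | nil =>
    have : Subsingleton N'' := h''
    exact h'.congr (LinearEquiv.ofBijective f
      ⟨hf, fun y ↦ (hfg y).mp (Subsingleton.elim _ _)⟩)
  | cons P l ih =>
    obtain ⟨K, hK, ⟨φ⟩⟩ := h''
    let q : N →ₗ[R] N'' ⧸ K := K.mkQ ∘ₗ g
    have hq : ∀ x ∈ LinearMap.ker q, g x ∈ K := fun x hx ↦ by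
      simpa [q] using hx
    have hfq : ∀ x, f x ∈ LinearMap.ker q := fun x ↦ by
      simp [q, hfg.apply_apply_eq_zero]
    refine ⟨LinearMap.ker q, ih (f := f.codRestrict _ hfq) (g := g.restrict hq) ?_ ?_ ?_ hK,
      ⟨(q.quotKerEquivOfSurjective (K.mkQ_surjective.comp hg)).trans φ⟩⟩
    · exact fun x y hxy ↦ hf (congrArg Subtype.val hxy)
    · rintro ⟨y, hy⟩
      obtain ⟨x, rfl⟩ := hg y
      exact ⟨⟨x, by simpa [q] using hy⟩, rfl⟩
    · rintro ⟨x, hx⟩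
      have := hfg x
      simp only [Subtype.ext_iff, Set.mem_range, LinearMap.restrict_apply,
        LinearMap.codRestrict_apply, ZeroMemClass.coe_zero]
      exact this

/-- An `R`-module is isomorphic to `R ⧸ P` for at most one ideal `P`, its annihilator. -/
theorem _root_.PrimeSpectrum.eq_of_quotient_equiv {P Q : PrimeSpectrum R} {N : Type v}
    [AddCommGroup N] [Module R N] (e : N ≃ₗ[R] (R ⧸ P.asIdeal)) (e' : N ≃ₗ[R] (R ⧸ Q.asIdeal)) :
    P = Q := by
  ext1
  rw [← Ideal.annihilator_quotient (I := P.asIdeal), ← Ideal.annihilator_quotient (I := Q.asIdeal)]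
  exact (e.symm.trans e').annihilator_eq

/-- The recursive description of a prime filtration of a submodule `K`, unfolded to a series of
submodules of the ambient module. -/
theorem exists_relSeries {l : List (PrimeSpectrum R)} {N : Type v} [AddCommGroup N] [Module R N]
    (K : Submodule R N) (h : HasPrimeFactors R l K) :
    ∃ s : RelSeries {(N₁, N₂) : Submodule R N × Submodule R N |
        Submodule.IsQuotientEquivQuotientPrime N₁ N₂},
      s.head = ⊥ ∧ s.last = K ∧ s.length = l.length ∧
      ∀ P : PrimeSpectrum R, (∃ i : Fin s.length, Nonempty
        ((↥(s i.succ) ⧸ (s i.castSucc).submoduleOf (s i.succ)) ≃ₗ[R] (R ⧸ P.asIdeal))) ↔ P ∈ l := by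
  induction l generalizing K with
  | nil =>
    have : Subsingleton K := h
    refine ⟨RelSeries.singleton _ ⊥, rfl, ?_, rfl, fun P ↦ ?_⟩
    · exact ((Submodule.subsingleton_iff_eq_bot).mp this).symm
    · simp only [List.not_mem_nil, iff_false]
      rintro ⟨i, -⟩
      exact i.elim0
  | cons P l ih =>
    obtain ⟨K', hK', ⟨φ⟩⟩ := h
    obtain ⟨s, hs0, hs1, hs2, hs3⟩ := ih (K'.map K.subtype)
      (hK'.congr (K'.equivMapOfInjective K.subtype K.injective_subtype))
    have heq : (K'.map K.subtype).submoduleOf K = K' :=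
      Submodule.comap_map_eq_of_injective K.injective_subtype K'
    have hφ : Nonempty ((K ⧸ (K'.map K.subtype).submoduleOf K) ≃ₗ[R] (R ⧸ P.asIdeal)) :=
      ⟨(Submodule.quotEquivOfEq _ _ heq).trans φ⟩
    have hrel : Submodule.IsQuotientEquivQuotientPrime s.last K := by
      rw [hs1]
      exact ⟨Submodule.map_subtype_le K K', P, hφ⟩
    refine ⟨s.snoc K hrel, by simpa using hs0, by simp, by simp [hs2], fun Q ↦ ?_⟩
    rw [List.mem_cons, ← hs3 Q, or_comm]
    refine Fin.exists_fin_succ'.trans (or_congr ?_ ?_)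
    · refine exists_congr fun i ↦ ?_
      have h1 : (s.snoc K hrel) (Fin.succ (Fin.castSucc i)) = s i.succ :=
        s.snoc_castSucc K hrel i.succ
      have h2 : (s.snoc K hrel) (Fin.castSucc (Fin.castSucc i)) = s i.castSucc :=
        s.snoc_castSucc K hrel i.castSucc
      rw [h1, h2]
      rfl
    · have h1 : (s.snoc K hrel) (Fin.succ (Fin.last _)) = K := s.last_snoc K hrel
      have h2 : (s.snoc K hrel) (Fin.castSucc (Fin.last _)) = K'.map K.subtype :=
        (s.snoc_castSucc K hrel (Fin.last _)).trans hs1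
      refine (iff_of_eq (by rw [h1, h2])).trans (b := Nonempty
        ((K ⧸ (K'.map K.subtype).submoduleOf K) ≃ₗ[R] (R ⧸ Q.asIdeal))) ⟨?_, ?_⟩
      · rintro ⟨ψ⟩
        exact PrimeSpectrum.eq_of_quotient_equiv ψ hφ.some
      · rintro rfl
        exact hφ

theorem exists_primeFiltration {l : List (PrimeSpectrum R)} {N : Type v} [AddCommGroup N]
    [Module R N] (h : HasPrimeFactors R l N) :
    ∃ G : PrimeFiltration R N, G.factors = {P | P ∈ l} ∧ ∀ P, G.multiplicity P ≤ l.length := by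
  obtain ⟨s, hs0, hs1, hs2, hs3⟩ := exists_relSeries ⊤ (h.congr Submodule.topEquiv.symm)
  refine ⟨⟨s, hs0, hs1⟩, Set.ext hs3, fun P ↦ ?_⟩
  rw [← hs2]
  exact (Set.ncard_le_card _).trans_eq (Nat.card_fin _)

end HasPrimeFactors

/-! ### The dimension of Rees algebras of domains -/

section KrullDim

open Polynomial

/-- Two primes `P < Q` satisfy `dim (S ⧸ Q) + 1 ≤ dim (S ⧸ P)`. -/
theorem ringKrullDim_quotient_add_one_le_of_lt {S : Type*} [CommRing S] {P Q : Ideal S}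
    [P.IsPrime] (h : P < Q) : ringKrullDim (S ⧸ Q) + 1 ≤ ringKrullDim (S ⧸ P) := by
  obtain ⟨hle, x, hxQ, hxP⟩ := SetLike.lt_iff_le_and_exists.mp h
  refine ringKrullDim_succ_le_of_surjective (Ideal.Quotient.factor hle)
    (Ideal.Quotient.factor_surjective hle) (r := Ideal.Quotient.mk P x) ?_ ?_
  · exact mem_nonZeroDivisors_of_ne_zero (by rwa [Ne, Ideal.Quotient.eq_zero_iff_mem])
  · rw [Ideal.Quotient.factor_mk]
    exact Ideal.Quotient.eq_zero_iff_mem.mpr hxQ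

variable {R : Type*} [CommRing R] {L : Type*} [CommRing L] [Algebra R L]

theorem Algebra.exists_aeval_eq_of_mem_adjoin_insert {s : Set L} {x y : L}
    (hy : y ∈ Algebra.adjoin R (insert x s)) : ∃ p : (Algebra.adjoin R s)[X], aeval x p = y := by
  have : y ∈ Algebra.adjoin (Algebra.adjoin R s) {x} := by
    rwa [Set.insert_eq, Set.union_comm, Algebra.adjoin_union_eq_adjoin_adjoin] at hy
  rwa [Algebra.adjoin_singleton_eq_range_aeval] at this

theorem Algebra.aeval_mem_adjoin_insert (s : Set L) (x : L) (p : (Algebra.adjoin R s)[X]) :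
    aeval x p ∈ Algebra.adjoin R (insert x s) := by
  rw [Set.insert_eq, Set.union_comm, Algebra.adjoin_union_eq_adjoin_adjoin]
  change aeval x p ∈ Algebra.adjoin (Algebra.adjoin R s) {x}
  rw [Algebra.adjoin_singleton_eq_range_aeval]
  exact ⟨p, rfl⟩

/-- Evaluation at `x`, as a surjection from the polynomials over `R[s]` onto `R[s, x]`. -/
noncomputable def Algebra.evalAdjoinInsert (s : Set L) (x : L) :
    (Algebra.adjoin R s)[X] →+* Algebra.adjoin R (insert x s) :=
  (aeval x : (Algebra.adjoin R s)[X] →ₐ[Algebra.adjoin R s] L).toRingHom.codRestrict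
    (Algebra.adjoin R (insert x s)) (Algebra.aeval_mem_adjoin_insert s x)

theorem Algebra.evalAdjoinInsert_surjective (s : Set L) (x : L) :
    Function.Surjective (Algebra.evalAdjoinInsert (R := R) s x) := fun y ↦ by
  obtain ⟨p, hp⟩ := Algebra.exists_aeval_eq_of_mem_adjoin_insert y.2
  exact ⟨p, Subtype.ext hp⟩

/-- Adjoining one element to a Noetherian ring raises its dimension by at most one. -/
theorem ringKrullDim_adjoin_insert_le_add_one [IsNoetherianRing R] {s : Set L} (hs : s.Finite)
    (x : L) : ringKrullDim (Algebra.adjoin R (insert x s)) ≤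
      ringKrullDim (Algebra.adjoin R s) + 1 := by
  have : IsNoetherianRing (Algebra.adjoin R s) :=
    isNoetherianRing_of_fg ⟨hs.toFinset, by rw [hs.coe_toFinset]⟩
  rw [← Polynomial.ringKrullDim_of_isNoetherianRing]
  exact ringKrullDim_le_of_surjective _ (Algebra.evalAdjoinInsert_surjective s x)

/-- Adjoining an element of the fraction field does not raise the dimension of a Noetherian
domain. -/
theorem ringKrullDim_adjoin_insert_le [IsNoetherianRing R] [IsDomain L] {s : Set L}
    (hs : s.Finite) {x c : L} (hc : c ∈ Algebra.adjoin R s) (hc0 : c ≠ 0)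
    (hcx : c * x ∈ Algebra.adjoin R s) :
    ringKrullDim (Algebra.adjoin R (insert x s)) ≤ ringKrullDim (Algebra.adjoin R s) := by
  have : IsNoetherianRing (Algebra.adjoin R s) :=
    isNoetherianRing_of_fg ⟨hs.toFinset, by rw [hs.coe_toFinset]⟩
  -- The kernel of the evaluation at `x` contains the nonzero polynomial `c X - c x`.
  let r : (Algebra.adjoin R s)[X] := C ⟨c, hc⟩ * X - C ⟨c * x, hcx⟩
  have hr : r ≠ 0 := fun h ↦ hc0 <| by
    have h1 := congrArg (fun p ↦ p.coeff 1) h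
    exact congrArg Subtype.val (show (⟨c, hc⟩ : Algebra.adjoin R s) = 0 by
      simpa [r, coeff_C] using h1)
  have key := ringKrullDim_succ_le_of_surjective _ (Algebra.evalAdjoinInsert_surjective s x)
    (mem_nonZeroDivisors_of_ne_zero hr) (Subtype.ext (by
      change aeval x r = 0
      simp [r]))
  rw [Polynomial.ringKrullDim_of_isNoetherianRing] at key
  exact ENat.WithBot.add_le_add_one_right_iff.mp key

/-- The homomorphism `R[Xᵢ : i ∈ σ] → R[t]` sending `Xᵢ` to `aᵢ t`, whose image is the Rees algebra
of the ideal generated by the `aᵢ`. -/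
noncomputable def toRees {σ : Type*} (a : σ → R) : MvPolynomial σ R →ₐ[R] R[X] :=
  MvPolynomial.aeval fun i ↦ C (a i) * X

/-- The Rees algebra of an ideal of a Noetherian domain `R ⧸ 𝔭` has dimension at most
`dim (R ⧸ 𝔭) + 1`. -/
theorem ringKrullDim_quotient_comap_toRees_le [IsNoetherianRing R] {σ : Type*} [Finite σ]
    (a : σ → R) (𝔭 : Ideal R) [𝔭.IsPrime] {i : σ} (hi : a i ∉ 𝔭) :
    ringKrullDim (MvPolynomial σ R ⧸ (𝔭.map C).comap (toRees a)) ≤ ringKrullDim (R ⧸ 𝔭) + 1 := by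
  classical
  have := Fintype.ofFinite σ
  let y : σ → (R ⧸ 𝔭)[X] := fun j ↦ C (Ideal.Quotient.mk 𝔭 (a j)) * X
  have hy : y i ≠ 0 := by
    simpa [y, Ideal.Quotient.eq_zero_iff_mem, X_ne_zero] using hi
  have hbot : ringKrullDim (Algebra.adjoin R (∅ : Set (R ⧸ 𝔭)[X])) ≤ ringKrullDim (R ⧸ 𝔭) := by
    refine ringKrullDim_le_of_surjective
      (Ideal.Quotient.lift 𝔭 (algebraMap R (Algebra.adjoin R (∅ : Set (R ⧸ 𝔭)[X]))) ?_) ?_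
    · intro r hr
      refine Subtype.ext ?_
      change algebraMap R (R ⧸ 𝔭)[X] r = 0
      rw [IsScalarTower.algebraMap_apply R (R ⧸ 𝔭) (R ⧸ 𝔭)[X], Ideal.Quotient.algebraMap_eq,
        Ideal.Quotient.eq_zero_iff_mem.mpr hr, map_zero]
    · refine Ideal.Quotient.lift_surjective_of_surjective _ _ ?_
      rintro ⟨z, hz⟩
      rw [Algebra.adjoin_empty] at hz
      obtain ⟨r, rfl⟩ := hz
      exact ⟨r, rfl⟩
  have hfin : ∀ s : Finset σ, ringKrullDim (Algebra.adjoin R (insert (y i) (y '' s))) ≤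
      ringKrullDim (R ⧸ 𝔭) + 1 := by
    intro s
    induction s using Finset.induction_on with
    | empty =>
      rw [Finset.coe_empty, Set.image_empty]
      exact (ringKrullDim_adjoin_insert_le_add_one Set.finite_empty _).trans (by gcongr)
    | insert j s _ ih =>
      rw [Finset.coe_insert, Set.image_insert_eq, Set.insert_comm]
      refine (ringKrullDim_adjoin_insert_le ((s.finite_toSet.image y).insert _)
        (c := algebraMap R (R ⧸ 𝔭)[X] (a i)) (Subalgebra.algebraMap_mem _ _) ?_ ?_).trans ih
      · intro h
        apply hi
        rw [IsScalarTower.algebraMap_apply R (R ⧸ 𝔭) (R ⧸ 𝔭)[X], Polynomial.algebraMap_eq,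
          Polynomial.C_eq_zero] at h
        exact Ideal.Quotient.eq_zero_iff_mem.mp h
      -- `aᵢ * (aⱼ t) = aⱼ * (aᵢ t)`
      · have : algebraMap R (R ⧸ 𝔭)[X] (a i) * y j = algebraMap R (R ⧸ 𝔭)[X] (a j) * y i := by
          simp only [y, IsScalarTower.algebraMap_apply R (R ⧸ 𝔭) (R ⧸ 𝔭)[X], Polynomial.algebraMap_eq,
            Ideal.Quotient.algebraMap_eq]
          ring
        rw [this]
        exact mul_mem (Subalgebra.algebraMap_mem _ _)
          (Algebra.subset_adjoin (Set.mem_insert _ _))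
  let ψ : MvPolynomial σ R →ₐ[R] (R ⧸ 𝔭)[X] := MvPolynomial.aeval y
  have hψ : ψ = (mapAlgHom (Ideal.Quotient.mkₐ R 𝔭)).comp (toRees a) := by
    ext j
    simp [ψ, y, toRees]
  have hker : (𝔭.map C).comap (toRees a) = RingHom.ker ψ.toRingHom := by
    ext p
    have h1 : ψ p = (toRees a p).map (Ideal.Quotient.mk 𝔭) := by rw [hψ]; rfl
    change toRees a p ∈ 𝔭.map C ↔ ψ p = 0
    rw [h1, Ideal.mem_map_C_iff, Polynomial.ext_iff]
    simp [Ideal.Quotient.eq_zero_iff_mem]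
  rw [hker, ringKrullDim_eq_of_ringEquiv (RingHom.quotientKerEquivRange ψ.toRingHom)]
  have hrange : (Algebra.adjoin R (insert (y i) (y '' (Finset.univ : Finset σ)))) = ψ.range := by
    rw [Finset.coe_univ, Set.image_univ, Set.insert_eq_of_mem (Set.mem_range_self i),
      Algebra.adjoin_range_eq_range_aeval]
  have := hfin Finset.univ
  rw [hrange] at this
  exact this

end KrullDim

/-! ### Families of modules whose prime factors grow polynomially -/

section Growth

/-- The modules `N n` have prime filtrations with factors in a common finite set of primes such
that, for every `d ∈ D`, the first `n` of them together have `O(n ^ d)` factors. -/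
def HasPrimeFactorsGrowth (R : Type u) [CommRing R] (N : ℕ → Type v) [∀ n, AddCommGroup (N n)]
    [∀ n, Module R (N n)] (D : Set ℕ) : Prop :=
  ∃ l : ℕ → List (PrimeSpectrum R), {P | ∃ n, P ∈ l n}.Finite ∧
    (∀ n, HasPrimeFactors R (l n) (N n)) ∧
    ∀ d ∈ D, ∃ C : ℕ, ∀ n, ∑ k ∈ Finset.range n, (l k).length ≤ C * (n + 1) ^ d

namespace HasPrimeFactorsGrowth

variable {R : Type u} [CommRing R]

theorem mono {N : ℕ → Type v} [∀ n, AddCommGroup (N n)] [∀ n, Module R (N n)] {D D' : Set ℕ}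
    (hD : D ⊆ D') (h : HasPrimeFactorsGrowth R N D') : HasPrimeFactorsGrowth R N D := by
  obtain ⟨l, h1, h2, h3⟩ := h
  exact ⟨l, h1, h2, fun d hd ↦ h3 d (hD hd)⟩

theorem of_subsingleton {N : ℕ → Type v} [∀ n, AddCommGroup (N n)] [∀ n, Module R (N n)]
    (D : Set ℕ) (h : ∀ n, Subsingleton (N n)) : HasPrimeFactorsGrowth R N D :=
  ⟨fun _ ↦ [], by simp, h, fun _ _ ↦ ⟨0, by simp⟩⟩

theorem _root_.Finset.sum_range_shift_le (f : ℕ → ℕ) (a n : ℕ) :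
    ∑ k ∈ Finset.range n, (if a ≤ k then f (k - a) else 0) ≤ ∑ k ∈ Finset.range n, f k := by
  have h : ∑ k ∈ Finset.range n, (if a ≤ k then f (k - a) else 0) =
      ∑ k ∈ Finset.range (n - a), f k := by
    induction n with
    | zero => simp
    | succ n ih =>
      rw [Finset.sum_range_succ, ih]
      split_ifs with h
      · rw [Nat.succ_sub h, Finset.sum_range_succ]
      · rw [show n + 1 - a = n - a by omega, add_zero]
  rw [h]
  exact Finset.sum_le_sum_of_subset (Finset.range_mono (Nat.sub_le _ _))

/-- Growth of prime factors is additive in families of extensions of `N₁ (n - a)` and `N₂ n`, in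
either order. -/
theorem of_shift {N₁ : ℕ → Type v} [∀ n, AddCommGroup (N₁ n)] [∀ n, Module R (N₁ n)]
    {N₂ : ℕ → Type w} [∀ n, AddCommGroup (N₂ n)] [∀ n, Module R (N₂ n)]
    {N : ℕ → Type w'} [∀ n, AddCommGroup (N n)] [∀ n, Module R (N n)] {D : Set ℕ} (a : ℕ)
    (hlt : ∀ n < a, ∀ l, HasPrimeFactors R l (N₂ n) → HasPrimeFactors R l (N n))
    (hge : ∀ n l₁ l₂, HasPrimeFactors R l₁ (N₁ n) → HasPrimeFactors R l₂ (N₂ (n + a)) →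
      ∃ l, l.Perm (l₁ ++ l₂) ∧ HasPrimeFactors R l (N (n + a)))
    (h₁ : HasPrimeFactorsGrowth R N₁ D) (h₂ : HasPrimeFactorsGrowth R N₂ D) :
    HasPrimeFactorsGrowth R N D := by
  obtain ⟨l₁, hΛ₁, hl₁, hD₁⟩ := h₁
  obtain ⟨l₂, hΛ₂, hl₂, hD₂⟩ := h₂
  have key : ∀ n, ∃ l, l.Perm ((if a ≤ n then l₁ (n - a) else []) ++ l₂ n) ∧
      HasPrimeFactors R l (N n) := by
    intro n
    split_ifs with h
    · obtain ⟨m, rfl⟩ := Nat.exists_eq_add_of_le' h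
      rw [Nat.add_sub_cancel]
      exact hge m _ _ (hl₁ m) (hl₂ _)
    · exact ⟨l₂ n, by simp, hlt n (not_le.mp h) _ (hl₂ n)⟩
  choose l hl hN using key
  refine ⟨l, (hΛ₁.union hΛ₂).subset ?_, hN, fun d hd ↦ ?_⟩
  · rintro P ⟨n, hP⟩
    rw [(hl n).mem_iff, List.mem_append] at hP
    rcases hP with hP | hP
    · split_ifs at hP with h
      · exact .inl ⟨_, hP⟩
      · simp at hP
    · exact .inr ⟨_, hP⟩
  · obtain ⟨C₁, hC₁⟩ := hD₁ d hd
    obtain ⟨C₂, hC₂⟩ := hD₂ d hd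
    refine ⟨C₁ + C₂, fun n ↦ ?_⟩
    have hlen : ∀ k, (l k).length = (if a ≤ k then (l₁ (k - a)).length else 0) +
        (l₂ k).length := by
      intro k
      rw [(hl k).length_eq, List.length_append]
      split_ifs <;> rfl
    simp only [hlen, Finset.sum_add_distrib, add_mul]
    exact add_le_add ((Finset.sum_range_shift_le _ a n).trans (hC₁ n)) (hC₂ n)

end HasPrimeFactorsGrowth

end Growth

/-! ### Cyclic graded modules -/

section Graded

variable {R : Type u} [CommRing R] {S : Type v} [CommRing S] [Algebra R S]
  (𝒜 : ℕ → Submodule R S)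

/-- The degree `n` component of the graded ring `S ⧸ J`, where `J` is a homogeneous ideal. -/
abbrev GradedPiece (J : Ideal S) (n : ℕ) : Type v :=
  𝒜 n ⧸ (J.restrictScalars R).submoduleOf (𝒜 n)

variable {𝒜} in
theorem gradedPiece_subset_of_subset (hgen : ∀ n, 𝒜 1 ^ n = 𝒜 n) {J : Ideal S}
    (hJ : (𝒜 1 : Set S) ⊆ J) {n : ℕ} (hn : n ≠ 0) : (𝒜 n : Set S) ⊆ J := by
  obtain ⟨m, rfl⟩ := Nat.exists_eq_succ_of_ne_zero hn
  have : 𝒜 (m + 1) ≤ J.restrictScalars R := by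
    rw [← hgen, pow_succ, Submodule.mul_le]
    exact fun x _ y hy ↦ J.mul_mem_left x (hJ hy)
  exact this

variable {𝒜} in
/-- If `J` is a prime containing the irrelevant ideal, then `S ⧸ J` is `R ⧸ (J ∩ R)`, in
degree `0`. -/
theorem hasPrimeFactorsGrowth_of_irrelevant_le (hgen : ∀ n, 𝒜 1 ^ n = 𝒜 n) {J : Ideal S}
    (hJp : J.IsPrime) (hJ : (𝒜 1 : Set S) ⊆ J) (D : Set ℕ) :
    HasPrimeFactorsGrowth R (GradedPiece 𝒜 J) D := by
  refine ⟨fun n ↦ if n = 0 then [⟨J.comap (algebraMap R S), inferInstance⟩] else [], ?_, ?_, ?_⟩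
  · refine (Set.finite_singleton (⟨J.comap (algebraMap R S), inferInstance⟩ :
      PrimeSpectrum R)).subset ?_
    rintro P ⟨n, hP⟩
    dsimp only at hP
    split_ifs at hP
    · simpa using hP
    · simp at hP
  · intro n
    have hz := hgen 0
    rw [pow_zero] at hz
    dsimp only
    split_ifs with hn
    · subst hn
      let g : R →ₗ[R] 𝒜 0 := (Algebra.linearMap R S).codRestrict _ fun r ↦ by
        rw [← hz]
        exact Submodule.algebraMap_mem r
      let q := ((J.restrictScalars R).submoduleOf (𝒜 0)).mkQ ∘ₗ g
      have hq : Function.Surjective q := by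
        refine (Submodule.mkQ_surjective _).comp ?_
        rintro ⟨y, hy⟩
        rw [← hz] at hy
        obtain ⟨r, rfl⟩ := Submodule.mem_one.mp hy
        exact ⟨r, rfl⟩
      have hker : LinearMap.ker q = J.comap (algebraMap R S) := by
        rw [LinearMap.ker_comp, Submodule.ker_mkQ]
        rfl
      have hS : HasPrimeFactors R [] (⊥ : Submodule R (GradedPiece 𝒜 J 0)) :=
        inferInstanceAs (Subsingleton (⊥ : Submodule R (GradedPiece 𝒜 J 0)))
      exact ⟨⊥, hS, ⟨(Submodule.quotEquivOfEqBot ⊥ rfl).trans <|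
        (q.quotKerEquivOfSurjective hq).symm.trans (Submodule.quotEquivOfEq _ _ hker)⟩⟩
    · refine Submodule.Quotient.subsingleton_iff.mpr (eq_top_iff.mpr fun x _ ↦ ?_)
      exact gradedPiece_subset_of_subset hgen hJ hn x.2
  · refine fun d _ ↦ ⟨1, fun n ↦ ?_⟩
    refine le_trans ?_ (Nat.mul_le_mul_left 1 (Nat.one_le_pow _ _ n.succ_pos))
    have h : ∀ k, (if k = 0 then [(⟨J.comap (algebraMap R S), inferInstance⟩ :
        PrimeSpectrum R)] else []).length = if k = 0 then 1 else 0 := by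
      intro k
      split_ifs <;> rfl
    simp only [h, Finset.sum_ite_eq']
    split_ifs <;> simp

variable [GradedAlgebra 𝒜] {𝒜}

open DirectSum in
theorem Ideal.IsHomogeneous.exists_sub_mul_mem {J : Ideal S} (hJ : J.IsHomogeneous 𝒜) {f : S}
    {a : ℕ} (hf : f ∈ 𝒜 a) {n : ℕ} {y : S} (hy : y ∈ 𝒜 (n + a)) (hyJ : y ∈ J ⊔ Ideal.span {f}) :
    ∃ q ∈ 𝒜 n, y - q * f ∈ J := by
  obtain ⟨j, hj, z, hz, rfl⟩ := Submodule.mem_sup.mp hyJ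
  obtain ⟨c, rfl⟩ := Ideal.mem_span_singleton'.mp hz
  refine ⟨decompose 𝒜 c n, SetLike.coe_mem _, ?_⟩
  have h := decompose_of_mem_same 𝒜 hy
  rw [decompose_add, DirectSum.add_apply, Submodule.coe_add,
    coe_decompose_mul_add_of_right_mem 𝒜 hf] at h
  rw [← h, add_sub_cancel_right]
  exact hJ (n + a) hj

open DirectSum in
theorem Ideal.IsHomogeneous.mem_of_mem_sup_span_singleton {J : Ideal S} (hJ : J.IsHomogeneous 𝒜)
    {f : S} {a : ℕ} (hf : f ∈ 𝒜 a) {n : ℕ} (hn : n < a) {y : S} (hy : y ∈ 𝒜 n)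
    (hyJ : y ∈ J ⊔ Ideal.span {f}) : y ∈ J := by
  obtain ⟨j, hj, z, hz, rfl⟩ := Submodule.mem_sup.mp hyJ
  obtain ⟨c, rfl⟩ := Ideal.mem_span_singleton'.mp hz
  have h := decompose_of_mem_same 𝒜 hy
  rw [decompose_add, DirectSum.add_apply, Submodule.coe_add,
    coe_decompose_mul_of_right_mem_of_not_le 𝒜 hf (not_le.mpr hn), add_zero] at h
  rw [← h]
  exact hJ n hj

/-- The degree `n + a` part of `0 → (S ⧸ J')(-a) → S ⧸ J → S ⧸ (J + f) → 0`, where `f` has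
degree `a` and `J' = (J : f)`. -/
theorem HasPrimeFactors.gradedPiece_of_ge {J J' : Ideal S} (hJ : J.IsHomogeneous 𝒜) {f : S} {a : ℕ}
    (hf : f ∈ 𝒜 a) (hJ' : ∀ x, x ∈ J' ↔ x * f ∈ J) {n : ℕ} {l' l'' : List (PrimeSpectrum R)}
    (h' : HasPrimeFactors R l' (GradedPiece 𝒜 J' n))
    (h'' : HasPrimeFactors R l'' (GradedPiece 𝒜 (J ⊔ Ideal.span {f}) (n + a))) :
    HasPrimeFactors R (l'' ++ l') (GradedPiece 𝒜 J (n + a)) := by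
  let μ : 𝒜 n →ₗ[R] 𝒜 (n + a) :=
    (LinearMap.mulRight R f).restrict fun x hx ↦ SetLike.mul_mem_graded hx hf
  have hμ : ∀ x, x ∈ (J'.restrictScalars R).submoduleOf (𝒜 n) ↔
      μ x ∈ (J.restrictScalars R).submoduleOf (𝒜 (n + a)) := fun x ↦ hJ' x
  have hle : (J.restrictScalars R).submoduleOf (𝒜 (n + a)) ≤
      ((J ⊔ Ideal.span {f}).restrictScalars R).submoduleOf (𝒜 (n + a)) :=
    fun x hx ↦ Ideal.mem_sup_left (T := Ideal.span {f}) hx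
  refine HasPrimeFactors.of_exact (f := Submodule.mapQ _ _ μ fun x hx ↦ (hμ x).mp hx)
    (g := Submodule.factor hle) ?_ (Submodule.factor_surjective hle) ?_ h' h''
  · rw [injective_iff_map_eq_zero]
    intro x
    induction x using Submodule.Quotient.induction_on with | _ x => ?_
    rw [Submodule.mapQ_apply, Submodule.Quotient.mk_eq_zero, Submodule.Quotient.mk_eq_zero]
    exact (hμ x).mpr
  · intro y
    induction y using Submodule.Quotient.induction_on with | _ y => ?_
    rw [← Submodule.mkQ_apply, Submodule.factor_mk, Submodule.mkQ_apply,
      Submodule.Quotient.mk_eq_zero]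
    constructor
    · intro hy
      obtain ⟨q, hq, hqJ⟩ := hJ.exists_sub_mul_mem hf y.2 hy
      refine ⟨Submodule.Quotient.mk ⟨q, hq⟩, ?_⟩
      rw [Submodule.mapQ_apply, Submodule.mkQ_apply]
      exact ((Submodule.Quotient.eq ((J.restrictScalars R).submoduleOf (𝒜 (n + a)))).mpr hqJ).symm
    · rintro ⟨x, hx⟩
      induction x using Submodule.Quotient.induction_on with | _ x => ?_
      rw [Submodule.mapQ_apply, Submodule.mkQ_apply, Submodule.Quotient.eq] at hx
      have h1 : (x : S) * f - y ∈ J := hx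
      change (y : S) ∈ J ⊔ Ideal.span {f}
      have h2 : (y : S) = -(x * f - y) + x * f := by ring
      rw [h2]
      exact Submodule.add_mem_sup (neg_mem h1)
        (Ideal.mul_mem_left _ _ (Ideal.mem_span_singleton_self f))

/-- Below the degree of `f`, the quotients `S ⧸ J` and `S ⧸ (J + f)` agree. -/
theorem HasPrimeFactors.gradedPiece_of_lt {J : Ideal S} (hJ : J.IsHomogeneous 𝒜) {f : S} {a : ℕ}
    (hf : f ∈ 𝒜 a) {n : ℕ} (hn : n < a) {l : List (PrimeSpectrum R)}
    (h : HasPrimeFactors R l (GradedPiece 𝒜 (J ⊔ Ideal.span {f}) n)) :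
    HasPrimeFactors R l (GradedPiece 𝒜 J n) := by
  refine h.congr (Submodule.quotEquivOfEq _ _ (le_antisymm ?_ ?_))
  · exact fun x hx ↦ hJ.mem_of_mem_sup_span_singleton hf hn x.2 hx
  · exact fun x hx ↦ Ideal.mem_sup_left (T := Ideal.span {f}) hx

/-- The exponents that bound the dimensions of `S ⧸ Q`, for `Q` a homogeneous prime over `J` that
does not contain the irrelevant ideal. -/
def relevantDimBounds (𝒜 : ℕ → Submodule R S) [GradedAlgebra 𝒜] (J : Ideal S) : Set ℕ :=
  {d | ∀ Q : Ideal S, Q.IsPrime → Q.IsHomogeneous 𝒜 → J ≤ Q → ¬ (𝒜 1 : Set S) ⊆ Q →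
    ringKrullDim (S ⧸ Q) ≤ d}

theorem relevantDimBounds_mono {J J' : Ideal S} (h : J ≤ J') :
    relevantDimBounds 𝒜 J ⊆ relevantDimBounds 𝒜 J' :=
  fun _ hd Q hQ hQ' hJ ↦ hd Q hQ hQ' (h.trans hJ)

open DirectSum in
theorem Ideal.IsHomogeneous.of_forall_mul_mem {J J' : Ideal S} (hJ : J.IsHomogeneous 𝒜) {f : S}
    {a : ℕ} (hf : f ∈ 𝒜 a) (hJ' : ∀ x, x ∈ J' ↔ x * f ∈ J) : J'.IsHomogeneous 𝒜 := by
  intro n x hx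
  rw [hJ'] at hx ⊢
  rw [← coe_decompose_mul_add_of_right_mem 𝒜 hf]
  exact hJ (n + a) hx

/-- If `x ∉ J` has degree one and `J` is prime, then multiplication by `x` filters the degree `n`
part of `S ⧸ J` by the parts of degree at most `n` of `S ⧸ (J + x)`. -/
theorem hasPrimeFactorsGrowth_of_relevant {J : Ideal S} (hJp : J.IsPrime)
    (hJ : J.IsHomogeneous 𝒜) {x : S} (hx : x ∈ 𝒜 1) (hxJ : x ∉ J)
    (h : HasPrimeFactorsGrowth R (GradedPiece 𝒜 (J ⊔ Ideal.span {x}))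
      (relevantDimBounds 𝒜 (J ⊔ Ideal.span {x}))) :
    HasPrimeFactorsGrowth R (GradedPiece 𝒜 J) (relevantDimBounds 𝒜 J) := by
  obtain ⟨l, hΛ, hl, hD⟩ := h
  let L : ℕ → List (PrimeSpectrum R) := fun n ↦ Nat.rec (l 0) (fun n L ↦ l (n + 1) ++ L) n
  have hL : ∀ n, HasPrimeFactors R (L n) (GradedPiece 𝒜 J n) := by
    intro n
    induction n with
    | zero => exact (hl 0).gradedPiece_of_lt hJ hx one_pos
    | succ n ih =>
      refine HasPrimeFactors.gradedPiece_of_ge hJ hx (fun y ↦ ?_) ih (hl (n + 1))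
      exact ⟨fun hy ↦ J.mul_mem_right x hy, fun hy ↦ (hJp.mem_or_mem hy).resolve_right hxJ⟩
  refine ⟨L, hΛ.subset ?_, hL, fun d hd ↦ ?_⟩
  · rintro P ⟨n, hP⟩
    induction n with
    | zero => exact ⟨0, hP⟩
    | succ n ih => exact (List.mem_append.mp hP).elim (fun h ↦ ⟨_, h⟩) ih
  · have hJx : J < J ⊔ Ideal.span {x} :=
      lt_of_le_of_ne le_sup_left fun h ↦
        hxJ (h ▸ Ideal.mem_sup_right (Ideal.mem_span_singleton_self x))
    have hdim : ringKrullDim (S ⧸ J) ≤ d := hd J hJp hJ le_rfl fun h ↦ hxJ (h hx)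
    -- The prime generated by `J` and the irrelevant ideal shows that `S ⧸ J` has positive dimension.
    have hd0 : d ≠ 0 := by
      rintro rfl
      have hlt : J < J.comap (GradedRing.projZeroRingHom 𝒜) := by
        refine SetLike.lt_iff_le_and_exists.mpr ⟨fun y hy ↦ ?_, x, ?_, hxJ⟩
        · exact hJ 0 hy
        · rw [Ideal.mem_comap, GradedRing.projZeroRingHom_apply,
            DirectSum.decompose_of_mem_ne 𝒜 hx one_ne_zero]
          exact J.zero_mem
      have := (ringKrullDim_quotient_add_one_le_of_lt hlt).trans hdim
      rw [Nat.cast_zero, ENat.WithBot.add_one_le_zero_iff] at this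
      have h0 := ringKrullDim_nonneg_of_nontrivial
        (R := S ⧸ J.comap (GradedRing.projZeroRingHom 𝒜))
      simp [this] at h0
    obtain ⟨e, rfl⟩ := Nat.exists_eq_succ_of_ne_zero hd0
    obtain ⟨C, hC⟩ := hD e (by
      intro Q hQ _ hJQ _
      have := ringKrullDim_quotient_add_one_le_of_lt (hJx.trans_le hJQ)
      exact ENat.WithBot.add_le_add_one_right_iff.mp (this.trans (by exact_mod_cast hdim)))
    refine ⟨C, fun n ↦ ?_⟩
    have hlen : ∀ k, (L k).length = ∑ i ∈ Finset.range (k + 1), (l i).length := by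
      intro k
      induction k with
      | zero => simp [L]
      | succ k ih =>
        rw [Finset.sum_range_succ, ← ih, add_comm (L k).length]
        exact List.length_append
    calc ∑ k ∈ Finset.range n, (L k).length ≤ ∑ k ∈ Finset.range n, C * (n + 1) ^ e := by
          refine Finset.sum_le_sum fun k hk ↦ ?_
          rw [hlen]
          refine (hC (k + 1)).trans ?_
          gcongr
          exact Finset.mem_range.mp hk
      _ = n * (C * (n + 1) ^ e) := by simp
      _ ≤ C * (n + 1) ^ (e + 1) := by
          rw [pow_succ]
          nlinarith [Nat.zero_le (C * (n + 1) ^ e)]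

/-- For a homogeneous ideal `J` of a Noetherian standard graded algebra, the graded pieces of
`S ⧸ J` have prime factors in a common finite set, with growth bounded by the dimension.
By Noetherian induction: if `J` is not prime, there are homogeneous `f, g ∉ J` with `f g ∈ J`, and
`S ⧸ J` is an extension of `S ⧸ (J + f)` by a shift of `S ⧸ (J : f)`. -/
theorem hasPrimeFactorsGrowth_gradedPiece [IsNoetherianRing S] (hgen : ∀ n, 𝒜 1 ^ n = 𝒜 n)
    (J : Ideal S) (hJ : J.IsHomogeneous 𝒜) :
    HasPrimeFactorsGrowth R (GradedPiece 𝒜 J) (relevantDimBounds 𝒜 J) := by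
  induction J using WellFoundedGT.induction with | _ J ih => ?_
  have hspan : ∀ {f : S}, SetLike.IsHomogeneousElem 𝒜 f → (J ⊔ Ideal.span {f}).IsHomogeneous 𝒜 :=
    fun hf ↦ hJ.sup (Ideal.homogeneous_span 𝒜 _ fun y hy ↦ by
      rwa [Set.mem_singleton_iff.mp hy])
  have hlt : ∀ {f : S}, f ∉ J → J < J ⊔ Ideal.span {f} := fun hf ↦
    lt_of_le_of_ne le_sup_left fun h ↦
      hf (h ▸ Ideal.mem_sup_right (Ideal.mem_span_singleton_self _))
  by_cases hJp : J.IsPrime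
  · by_cases hirr : (𝒜 1 : Set S) ⊆ J
    · exact hasPrimeFactorsGrowth_of_irrelevant_le hgen hJp hirr _
    · obtain ⟨x, hx, hxJ⟩ := Set.not_subset.mp hirr
      exact hasPrimeFactorsGrowth_of_relevant hJp hJ hx hxJ
        (ih _ (hlt hxJ) (hspan ⟨1, hx⟩))
  by_cases htop : J = ⊤
  · refine .of_subsingleton _ fun n ↦ ?_
    subst htop
    exact Submodule.Quotient.subsingleton_iff.mpr (eq_top_iff.mpr fun _ _ ↦ trivial)
  have : ∃ f g, SetLike.IsHomogeneousElem 𝒜 f ∧ f ∉ J ∧ g ∉ J ∧ g * f ∈ J := by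
    by_contra! h
    refine hJp (hJ.isPrime_of_homogeneous_mem_or_mem htop fun {x y} hx _ hxy ↦ ?_)
    by_contra! hc
    exact h x y hx hc.1 hc.2 (by rwa [mul_comm])
  obtain ⟨f, g, ⟨a, hf⟩, hfJ, hgJ, hgf⟩ := this
  let J' : Ideal S := Submodule.comap (LinearMap.mulRight S f) J
  have hJ' : ∀ x, x ∈ J' ↔ x * f ∈ J := fun _ ↦ Iff.rfl
  have hJJ' : J < J' := SetLike.lt_iff_le_and_exists.mpr
    ⟨fun x hx ↦ J.mul_mem_right f hx, g, hgf, hgJ⟩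
  refine .of_shift a (fun n hn l hl ↦ hl.gradedPiece_of_lt hJ hf hn)
    (fun n l₁ l₂ h₁ h₂ ↦ ⟨l₂ ++ l₁, List.perm_append_comm,
      h₁.gradedPiece_of_ge hJ hf hJ' h₂⟩)
    ((ih J' hJJ' (hJ.of_forall_mul_mem hf hJ')).mono (relevantDimBounds_mono hJJ'.le))
    ((ih _ (hlt hfJ) (hspan ⟨a, hf⟩)).mono (relevantDimBounds_mono le_sup_left))

end Graded

/-! ### Relevant primes over the annihilator of a module -/

section Rees

open Polynomial

attribute [local instance] MvPolynomial.gradedAlgebra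

variable {R : Type u} [CommRing R] {σ : Type*} (a : σ → R)

theorem toRees_of_isHomogeneous {p : MvPolynomial σ R} {n : ℕ} (hp : p.IsHomogeneous n) :
    toRees a p = monomial n (MvPolynomial.eval a p) := by
  rw [toRees, MvPolynomial.aeval_def, MvPolynomial.eval₂_eq, MvPolynomial.eval_eq, map_sum]
  refine Finset.sum_congr rfl fun d hd ↦ ?_
  have hdn : ∑ i ∈ d.support, d i = n := by
    rw [← hp (MvPolynomial.mem_support_iff.mp hd)]
    simp [Finsupp.weight_apply, Finsupp.sum]
  rw [← C_mul_X_pow_eq_monomial, ← hdn]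
  simp [mul_pow, Finset.prod_mul_distrib, Finset.prod_pow_eq_pow_sum, mul_assoc]

theorem coeff_toRees (p : MvPolynomial σ R) (n : ℕ) :
    (toRees a p).coeff n = MvPolynomial.eval a (MvPolynomial.homogeneousComponent n p) := by
  induction p using MvPolynomial.induction_on' with
  | monomial d r =>
    have hd := MvPolynomial.isHomogeneous_monomial (d := d) r rfl
    rw [toRees_of_isHomogeneous a hd, coeff_monomial, MvPolynomial.homogeneousComponent_of_mem hd]
    split_ifs <;> first | rfl | omega
  | add p q hp hq => simp [hp, hq]

theorem coeff_toRees_mem (p : MvPolynomial σ R) (n : ℕ) :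
    (toRees a p).coeff n ∈ Ideal.span (Set.range a) ^ n := by
  rw [coeff_toRees, Ideal.mem_span_pow_iff_exists_isHomogeneous]
  exact ⟨_, MvPolynomial.homogeneousComponent_isHomogeneous n p, rfl⟩

/-- If the homogeneous ideal `J` contains the extensions of `I = (aᵢ)` and of the annihilator of `M`
(taken in the Rees algebra), then `dim (S ⧸ Q) ≤ dim M` for the homogeneous primes `Q` that contain
`J` but not the irrelevant ideal: such a `Q` strictly contains the extension of a prime `𝔭` of the
support of `M`, and the Rees algebra of `R ⧸ 𝔭` has dimension at most `dim (R ⧸ 𝔭) + 1`. -/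
theorem mem_relevantDimBounds [IsNoetherianRing R] [Finite σ] (M : Type v) [AddCommGroup M]
    [Module R M] [Module.Finite R M] {J : Ideal (MvPolynomial σ R)}
    (hann : ((Module.annihilator R M).map C).comap (toRees a) ≤ J)
    (ha : ∀ i, MvPolynomial.C (a i) ∈ J) {d : ℕ} (hd : Module.supportDim R M ≤ d) :
    d ∈ relevantDimBounds (MvPolynomial.homogeneousSubmodule σ R) J := by
  intro Q hQ _ hJQ hrel
  obtain ⟨q, hq, hqQ⟩ := Ideal.exists_minimalPrimes_le (hann.trans hJQ)
  obtain ⟨q', hq', hle, rfl⟩ := Ideal.exists_comap_eq_of_mem_minimalPrimes (toRees a).toRingHom q hq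
  let 𝔭 : Ideal R := q'.comap C
  have h𝔭 : 𝔭.IsPrime := inferInstance
  have h𝔭M : Module.annihilator R M ≤ 𝔭 := Ideal.map_le_iff_le_comap.mp hle
  have hrees : (𝔭.map C).comap (toRees a) ≤ Q :=
    (Ideal.comap_mono (Ideal.map_le_iff_le_comap.mpr le_rfl)).trans hqQ
  have hi : ∃ i, a i ∉ 𝔭 := by
    by_contra! h
    refine hrel ?_
    have : MvPolynomial.homogeneousSubmodule σ R 1 ≤ Q.restrictScalars R := by
      rw [MvPolynomial.homogeneousSubmodule_one_eq_span_X, Submodule.span_le]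
      rintro _ ⟨i, rfl⟩
      refine hrees ?_
      rw [Ideal.mem_comap, toRees, MvPolynomial.aeval_X]
      exact Ideal.mul_mem_right _ _ (Ideal.mem_map_of_mem _ (h i))
    exact this
  obtain ⟨i, hi⟩ := hi
  have hprime : ((𝔭.map C).comap (toRees a)).IsPrime := by
    have : (𝔭.map C).IsPrime := Ideal.isPrime_map_C_of_isPrime
    infer_instance
  have hlt : (𝔭.map C).comap (toRees a) < Q := by
    refine SetLike.lt_iff_le_and_exists.mpr ⟨hrees, _, hJQ (ha i), fun h ↦ hi ?_⟩
    rw [Ideal.mem_comap, toRees, MvPolynomial.aeval_C] at h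
    simpa using Ideal.mem_map_C_iff.mp h 0
  have h𝔭d : ringKrullDim (R ⧸ 𝔭) ≤ d := by
    rw [Module.supportDim_eq_ringKrullDim_quotient_annihilator] at hd
    exact (ringKrullDim_le_of_surjective _ (Ideal.Quotient.factor_surjective h𝔭M)).trans hd
  refine le_trans ?_ h𝔭d
  exact ENat.WithBot.add_le_add_one_right_iff.mp
    ((ringKrullDim_quotient_add_one_le_of_lt hlt).trans
      (ringKrullDim_quotient_comap_toRees_le a 𝔭 hi))

end Rees

/-! ### Filtered modules -/

section Filtration

open Polynomial

attribute [local instance] MvPolynomial.gradedAlgebra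

variable {R : Type u} [CommRing R] {I : Ideal R} {M : Type v} [AddCommGroup M] [Module R M]

/-- The subquotient `B / (A ∩ B)` of `M`. -/
abbrev Submodule.SubQuotient (A B : Submodule R M) : Type v := ↥B ⧸ A.submoduleOf B

theorem HasPrimeFactors.subQuotient_trans {A B B' : Submodule R M} (hAB : A ≤ B) (hBB' : B ≤ B')
    {l l' : List (PrimeSpectrum R)} (h : HasPrimeFactors R l (A.SubQuotient B))
    (h' : HasPrimeFactors R l' (B.SubQuotient B')) :
    HasPrimeFactors R (l' ++ l) (A.SubQuotient B') := by
  have hle : A.submoduleOf B' ≤ B.submoduleOf B' := fun x hx ↦ hAB hx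
  refine HasPrimeFactors.of_exact
    (f := Submodule.mapQ _ _ (Submodule.inclusion hBB') fun x hx ↦ hx)
    (g := Submodule.factor hle) ?_ (Submodule.factor_surjective hle) ?_ h h'
  · rw [injective_iff_map_eq_zero]
    intro x
    induction x using Submodule.Quotient.induction_on with | _ x => ?_
    rw [Submodule.mapQ_apply, Submodule.Quotient.mk_eq_zero, Submodule.Quotient.mk_eq_zero]
    exact id
  · intro y
    induction y using Submodule.Quotient.induction_on with | _ y => ?_
    rw [← Submodule.mkQ_apply, Submodule.factor_mk, Submodule.mkQ_apply,
      Submodule.Quotient.mk_eq_zero]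
    constructor
    · intro hy
      exact ⟨Submodule.Quotient.mk ⟨y, hy⟩, rfl⟩
    · rintro ⟨x, hx⟩
      induction x using Submodule.Quotient.induction_on with | _ x => ?_
      rw [Submodule.mapQ_apply, Submodule.mkQ_apply, Submodule.Quotient.eq] at hx
      have h1 : (x : M) - y ∈ A := hx
      change (y : M) ∈ B
      have h2 : (y : M) = x - (x - y) := by abel
      rw [h2]
      exact sub_mem x.2 (hAB h1)

namespace Ideal.Filtration

/-- The smallest `I`-filtration containing `K` whose `m`-th term contains `z`: its `n`-th term is
`K n + I ^ (n - m) z` for `n ≥ m`, and `K n` for `n < m`. The latter requires `z` to lie in the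
earlier terms of `K` already. -/
def adjoin (K : I.Filtration M) {m : ℕ} {z : M} (hz : ∀ n < m, z ∈ K.N n) : I.Filtration M where
  N n := K.N n ⊔ if m ≤ n then I ^ (n - m) • Submodule.span R {z} else ⊥
  mono n := by
    refine sup_le ((K.mono n).trans le_sup_left) ?_
    split_ifs with h1 h2 h2
    · refine le_sup_of_le_right (Submodule.smul_mono_left (Ideal.pow_le_pow_right (by omega)))
    · refine le_sup_of_le_left (Submodule.smul_le_right.trans ?_)
      rw [Submodule.span_singleton_le_iff_mem]
      exact hz n (not_le.mp h2)
    · exact bot_le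
    · exact bot_le
  smul_le n := by
    rw [Submodule.smul_sup]
    refine sup_le_sup (K.smul_le n) ?_
    split_ifs with h1 h2 h2
    · rw [← mul_smul, ← pow_succ', Nat.sub_add_comm h1]
    · omega
    · simp
    · simp

variable (K : I.Filtration M) {σ : Type*} (a : σ → R)

/-- The ideal of `R[Xᵢ : i ∈ σ]` of all polynomials whose image in the Rees algebra multiplies
`z`, placed in degree `m`, into the filtration `K`. -/
noncomputable def colonIdeal (ha : Ideal.span (Set.range a) = I) (m : ℕ) (z : M) :
    Ideal (MvPolynomial σ R) where
  carrier := {p | ∀ n, (toRees a p).coeff n • z ∈ K.N (n + m)}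
  zero_mem' n := by simp
  add_mem' hp hq n := by
    rw [map_add, coeff_add, add_smul]
    exact add_mem (hp n) (hq n)
  smul_mem' q p hp n := by
    rw [smul_eq_mul, map_mul, coeff_mul, Finset.sum_smul]
    refine Submodule.sum_mem _ fun x hx ↦ ?_
    rw [← Finset.HasAntidiagonal.mem_antidiagonal.mp hx, mul_smul, add_assoc]
    refine K.pow_smul_le _ _ (Submodule.smul_mem_smul ?_ (hp x.2))
    rw [← ha]
    exact coeff_toRees_mem a q x.1

variable {a} (ha : Ideal.span (Set.range a) = I) (m : ℕ) (z : M)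

theorem mem_colonIdeal_of_isHomogeneous {p : MvPolynomial σ R} {n : ℕ} (hp : p.IsHomogeneous n) :
    p ∈ K.colonIdeal a ha m z ↔ MvPolynomial.eval a p • z ∈ K.N (n + m) := by
  change (∀ k, (toRees a p).coeff k • z ∈ K.N (k + m)) ↔ _
  rw [toRees_of_isHomogeneous a hp]
  refine ⟨fun h ↦ by simpa using h n, fun h k ↦ ?_⟩
  rw [coeff_monomial]
  split_ifs with hk
  · exact hk ▸ h
  · simp

theorem isHomogeneous_colonIdeal :
    (K.colonIdeal a ha m z).IsHomogeneous (MvPolynomial.homogeneousSubmodule σ R) := by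
  intro n p hp
  have h := MvPolynomial.decomposition.decompose'_apply p n
  change ((MvPolynomial.decomposition.decompose' p n : _) : MvPolynomial σ R) ∈ _
  rw [h, K.mem_colonIdeal_of_isHomogeneous ha m z
    (MvPolynomial.homogeneousComponent_isHomogeneous n p), ← coeff_toRees]
  exact hp n

variable {m z}

/-- In degree `n`, the quotient of `K.adjoin z` by `K` is the degree `n - m` part of the cyclic
graded module generated by `z`. -/
theorem nonempty_gradedPiece_equiv (hz : ∀ n < m, z ∈ K.N n) (n : ℕ) :
    Nonempty (GradedPiece (MvPolynomial.homogeneousSubmodule σ R) (K.colonIdeal a ha m z) n ≃ₗ[R]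
      (K.N (n + m)).SubQuotient ((K.adjoin hz).N (n + m))) := by
  have hN : (K.adjoin hz).N (n + m) = K.N (n + m) ⊔ I ^ n • Submodule.span R {z} := by
    simp [adjoin]
  rw [hN]
  let g : MvPolynomial.homogeneousSubmodule σ R n →ₗ[R]
      ↥(K.N (n + m) ⊔ I ^ n • Submodule.span R {z}) :=
    ((LinearMap.toSpanSingleton R M z ∘ₗ (MvPolynomial.aeval a).toLinearMap).domRestrict
      _).codRestrict _ fun p ↦ Submodule.mem_sup_right <| Submodule.smul_mem_smul
        (by
          rw [← ha, Ideal.mem_span_pow_iff_exists_isHomogeneous]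
          exact ⟨p, p.2, by simp [MvPolynomial.aeval_eq_eval]⟩)
        (Submodule.mem_span_singleton_self z)
  have hg : ∀ p, (g p : M) = MvPolynomial.eval a (p : MvPolynomial σ R) • z := fun p ↦ by
    simp [g, MvPolynomial.aeval_eq_eval]
  let q := ((K.N (n + m)).submoduleOf (K.N (n + m) ⊔ I ^ n • Submodule.span R {z})).mkQ ∘ₗ g
  have hq : Function.Surjective q := by
    intro y
    induction y using Submodule.Quotient.induction_on with | _ y => ?_
    obtain ⟨y, hy⟩ := y
    obtain ⟨k, hk, w, hw, rfl⟩ := Submodule.mem_sup.mp hy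
    obtain ⟨r, hr, rfl⟩ := Submodule.mem_smul_span_singleton.mp hw
    rw [← ha, Ideal.mem_span_pow_iff_exists_isHomogeneous] at hr
    obtain ⟨p, hp, rfl⟩ := hr
    refine ⟨⟨p, hp⟩, (Submodule.Quotient.eq _).mpr ?_⟩
    change (g ⟨p, hp⟩ : M) - (k + MvPolynomial.eval a p • z) ∈ K.N (n + m)
    rw [hg, sub_add_cancel_right]
    exact neg_mem hk
  have hker : LinearMap.ker q = ((K.colonIdeal a ha m z).restrictScalars R).submoduleOf
      (MvPolynomial.homogeneousSubmodule σ R n) := by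
    rw [LinearMap.ker_comp, Submodule.ker_mkQ]
    ext p
    change (g p : M) ∈ K.N (n + m) ↔ (p : MvPolynomial σ R) ∈ K.colonIdeal a ha m z
    rw [hg, K.mem_colonIdeal_of_isHomogeneous ha m z p.2]
  exact ⟨(Submodule.quotEquivOfEq _ _ hker.symm).trans (q.quotKerEquivOfSurjective hq)⟩

variable [IsNoetherianRing R] [Module.Finite R M]

/-- If the graded submodule `⨁ K n / F (n + 1)` of the associated graded module of `F` has controlled
prime factors, so has the one obtained from it by adjoining a homogeneous element. -/
theorem hasPrimeFactorsGrowth_adjoin [Finite σ] (ha : Ideal.span (Set.range a) = I)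
    {F : I.Filtration M} (hFK : ∀ n, F.N (n + 1) ≤ K.N n) (hzF : z ∈ F.N m) (hz : ∀ n < m, z ∈ K.N n)
    (h : HasPrimeFactorsGrowth R (fun n ↦ (F.N (n + 1)).SubQuotient (K.N n))
      {d | Module.supportDim R M ≤ d}) :
    HasPrimeFactorsGrowth R (fun n ↦ (F.N (n + 1)).SubQuotient ((K.adjoin hz).N n))
      {d | Module.supportDim R M ≤ d} := by
  have hJ := hasPrimeFactorsGrowth_gradedPiece (R := R) (MvPolynomial.homogeneousSubmodule_one_pow R) _
    (K.isHomogeneous_colonIdeal ha m z)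
  refine .of_shift m (fun n hn l hl ↦ ?_) (fun n l₁ l₂ h₁ h₂ ↦ ?_) (hJ.mono fun d hd ↦ ?_) h
  · have hN : (K.adjoin hz).N n = K.N n := by simp [adjoin, not_le.mpr hn]
    rw [hN]
    exact hl
  · obtain ⟨e⟩ := K.nonempty_gradedPiece_equiv ha hz n
    exact ⟨l₁ ++ l₂, .refl _, h₂.subQuotient_trans (hFK _) le_sup_left (h₁.congr e)⟩
  · refine mem_relevantDimBounds a M (J := K.colonIdeal a ha m z) (fun p hp n ↦ ?_) (fun i ↦ ?_) hd
    · rw [Module.mem_annihilator.mp (Ideal.mem_map_C_iff.mp hp n)]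
      exact zero_mem _
    · rw [K.mem_colonIdeal_of_isHomogeneous ha m z (MvPolynomial.isHomogeneous_C σ (a i)),
        MvPolynomial.eval_C, zero_add]
      refine hFK m (F.smul_le m (Submodule.smul_mem_smul ?_ hzF))
      rw [← ha]
      exact Ideal.subset_span (Set.mem_range_self i)

/-- The filtration `n ↦ F (n + 1)`. -/
def succ (F : I.Filtration M) : I.Filtration M where
  N n := F.N (n + 1)
  mono n := F.mono (n + 1)
  smul_le n := F.smul_le (n + 1)

/-- Noetherian induction over the filtrations between `n ↦ F (n + 1)` and `F`, which correspond to
the graded submodules of the associated graded module. -/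
theorem hasPrimeFactorsGrowth_of_fg {F : I.Filtration M} (hF : F.submodule.FG) :
    HasPrimeFactorsGrowth R (fun n ↦ (F.N (n + 1)).SubQuotient (F.N n))
      {d | Module.supportDim R M ≤ d} := by
  have : IsNoetherian (reesAlgebra I) F.submodule := isNoetherian_of_fg_of_noetherian _ hF
  obtain ⟨k, a, ha⟩ := Submodule.fg_iff_exists_fin_generating_family.mp
    (IsNoetherian.noetherian I)
  -- A filtration `K` in between with the property, and not all of `F`, can be enlarged.
  have key : ∀ (T : Submodule (reesAlgebra I) F.submodule) (K : I.Filtration M),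
      K.submodule.submoduleOf F.submodule = T → (∀ n, F.N (n + 1) ≤ K.N n) → K ≤ F →
      HasPrimeFactorsGrowth R (fun n ↦ (F.N (n + 1)).SubQuotient (K.N n))
        {d | Module.supportDim R M ≤ d} →
      HasPrimeFactorsGrowth R (fun n ↦ (F.N (n + 1)).SubQuotient (F.N n))
        {d | Module.supportDim R M ≤ d} := by
    intro T
    induction T using WellFoundedGT.induction with | _ T ih => ?_
    rintro K rfl hFK hKF hK
    by_cases hle : F ≤ K
    · rwa [le_antisymm hKF hle] at hK
    obtain ⟨m, hm⟩ : ∃ m, ¬ F.N m ≤ K.N m := by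
      by_contra! h
      exact hle h
    obtain ⟨z, hzF, hzK⟩ := SetLike.not_le_iff_exists.mp hm
    have hz : ∀ n < m, z ∈ K.N n := fun n hn ↦ hFK n (F.antitone hn hzF)
    have hle' : ∀ n, K.N n ≤ (K.adjoin hz).N n := fun n ↦ le_sup_left
    refine ih _ ?_ (K.adjoin hz) rfl (fun n ↦ (hFK n).trans (hle' n)) (fun n ↦ ?_)
      (K.hasPrimeFactorsGrowth_adjoin ha hFK hzF hz hK)
    · refine SetLike.lt_iff_le_and_exists.mpr ⟨fun x hx n ↦ hle' n (hx n), ?_⟩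
      refine ⟨⟨PolynomialModule.single R m z, fun n ↦ ?_⟩, fun n ↦ ?_, fun h ↦ hzK ?_⟩
      · rw [PolynomialModule.coeff_single, Finsupp.single_apply]
        split_ifs with h
        · exact h ▸ hzF
        · exact zero_mem _
      · change (PolynomialModule.single R m z).coeff n ∈ _
        rw [PolynomialModule.coeff_single, Finsupp.single_apply]
        split_ifs with h
        · subst h
          refine Submodule.mem_sup_right ?_
          simp [Submodule.mem_span_singleton_self]
        · exact zero_mem _
      · have h1 : (PolynomialModule.single R m z).coeff m ∈ K.N m := h m
        simpa using h1
    · refine sup_le (hKF n) ?_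
      split_ifs with h
      · have h1 := F.pow_smul_le (n - m) m
        rw [Nat.sub_add_cancel h] at h1
        exact (smul_mono_right _
          ((Submodule.span_singleton_le_iff_mem _ _).mpr hzF)).trans h1
      · exact bot_le
  refine key _ F.succ rfl (fun n ↦ le_rfl) (fun n ↦ F.mono n) (.of_subsingleton _ fun n ↦ ?_)
  exact Submodule.Quotient.subsingleton_iff.mpr (Submodule.submoduleOf_self _)

end Ideal.Filtration

theorem HasPrimeFactors.quotient_of_le {A B : Submodule R M} (hAB : A ≤ B)
    {l l' : List (PrimeSpectrum R)} (h : HasPrimeFactors R l (A.SubQuotient B))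
    (h' : HasPrimeFactors R l' (M ⧸ B)) : HasPrimeFactors R (l' ++ l) (M ⧸ A) := by
  refine HasPrimeFactors.of_exact
    (f := Submodule.mapQ _ _ B.subtype fun x hx ↦ hx)
    (g := Submodule.factor hAB) ?_ (Submodule.factor_surjective hAB) ?_ h h'
  · rw [injective_iff_map_eq_zero]
    intro x
    induction x using Submodule.Quotient.induction_on with | _ x => ?_
    rw [Submodule.mapQ_apply, Submodule.Quotient.mk_eq_zero, Submodule.Quotient.mk_eq_zero]
    exact id
  · intro y
    induction y using Submodule.Quotient.induction_on with | _ y => ?_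
    rw [← Submodule.mkQ_apply, Submodule.factor_mk, Submodule.mkQ_apply,
      Submodule.Quotient.mk_eq_zero]
    constructor
    · intro hy
      exact ⟨Submodule.Quotient.mk ⟨y, hy⟩, rfl⟩
    · rintro ⟨x, hx⟩
      induction x using Submodule.Quotient.induction_on with | _ x => ?_
      rw [Submodule.mapQ_apply, Submodule.mkQ_apply, Submodule.Quotient.eq] at hx
      have h2 : y = (x : M) - (x - y) := by abel
      rw [h2]
      exact sub_mem x.2 (hAB hx)

end Filtration

theorem mainTheorem1 {R : Type u} [CommRing R] [IsNoetherianRing R] (I : Ideal R)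
    {M : Type v} [AddCommGroup M] [Module R M] (F : I.Filtration M) (hF : F.IsFilteredModule) :
    ∃ Λ : Set (PrimeSpectrum R), Λ.Finite ∧
      ∃ G : ∀ n : ℕ, PrimeFiltration R (M ⧸ F.N n),
        (∀ n, (G n).factors ⊆ Λ) ∧
        (∀ P ∈ Λ, ∀ d : ℕ, Module.supportDim R M ≤ (d : WithBot ℕ∞) →
          (fun n : ℕ => ((G n).multiplicity P : ℝ)) =O[atTop] (fun n : ℕ => (n : ℝ) ^ d)) ∧
        ((∀ m : Ideal R, m.IsMaximal → Infinite (R ⧸ m)) →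
          ∃ Λ' ⊆ Λ, ∀ᶠ n in atTop, (G n).factors = Λ') := by
  have := hF.finite
  obtain ⟨l, hΛ, hl, hD⟩ := F.hasPrimeFactorsGrowth_of_fg hF.rees_fg
  let L : ℕ → List (PrimeSpectrum R) := fun n ↦ Nat.rec [] (fun n L ↦ L ++ l n) n
  have hL : ∀ n, HasPrimeFactors R (L n) (M ⧸ F.N n) := by
    intro n
    induction n with
    | zero => exact Submodule.Quotient.subsingleton_iff.mpr hF.zero_eq_top
    | succ n ih => exact (hl n).quotient_of_le (F.mono n) ih
  have hmem : ∀ n P, P ∈ L n ↔ ∃ k < n, P ∈ l k := by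
    intro n P
    induction n with
    | zero => simp [L]
    | succ n ih =>
      refine List.mem_append.trans ?_
      rw [ih]
      constructor
      · rintro (⟨k, hk, h⟩ | h)
        · exact ⟨k, hk.trans n.lt_succ_self, h⟩
        · exact ⟨n, n.lt_succ_self, h⟩
      · rintro ⟨k, hk, h⟩
        rcases (Nat.lt_succ_iff_lt_or_eq.mp hk) with hk | rfl
        · exact .inl ⟨k, hk, h⟩
        · exact .inr h
  have hlen : ∀ n, (L n).length = ∑ k ∈ Finset.range n, (l k).length := by
    intro n
    induction n with
    | zero => rfl
    | succ n ih =>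
      rw [Finset.sum_range_succ, ← ih]
      exact List.length_append
  choose G hG hGlen using fun n ↦ (hL n).exists_primeFiltration
  have hsub : ∀ n, (G n).factors ⊆ {P | ∃ n, P ∈ l n} := by
    intro n P hP
    rw [hG, Set.mem_ofPred_eq, hmem] at hP
    obtain ⟨k, -, hk⟩ := hP
    exact ⟨k, hk⟩
  refine ⟨_, hΛ, G, hsub, fun P _ d hd ↦ ?_, fun _ ↦ ⟨_, subset_rfl, ?_⟩⟩
  · obtain ⟨C, hC⟩ := hD d hd
    refine IsBigO.of_bound (C * 2 ^ d : ℝ) ?_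
    filter_upwards [eventually_ge_atTop 1] with n hn
    have h1 : (G n).multiplicity P ≤ C * (2 * n) ^ d :=
      ((hGlen n P).trans ((hlen n).trans_le (hC n))).trans (by gcongr; omega)
    rw [Real.norm_of_nonneg (by positivity), Real.norm_of_nonneg (by positivity), mul_assoc,
      ← mul_pow]
    exact_mod_cast h1
  · -- The sets of factors increase with `n` and exhaust the finite set of all factors.
    have : ∀ᶠ n in atTop, ∀ P ∈ {P | ∃ n, P ∈ l n}, P ∈ L n := by
      refine (eventually_all_finite hΛ).mpr fun P ⟨k, hk⟩ ↦ ?_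
      filter_upwards [eventually_gt_atTop k] with n hn
      exact (hmem n P).mpr ⟨k, hn, hk⟩
    filter_upwards [this] with n hn
    refine (hsub n).antisymm fun P hP ↦ ?_
    rw [hG]
    exact hn P hP
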